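/- Let $n\ge 1$ items have unknown values $v=(v_1,\dots,v_n)\in\mathbb R^n$, and let $A_1,\dots,A_n$ be probability distributions on $\mathbb R$ such that, for every $i$, the function $x\mapsto x\cdot\Pr_{a\sim A_i}[|a|\ge x]$ is bounded on $[0,\infty)$. One observes $s=v+a$, where the noises $a_i\sim A_i$ are independent. A (randomized) algorithm, which may depend on $A_1,\dots,A_n$, is a measurable map $\mathrm{Alg}$ that sends each $s\in\mathbb R^n$ to a probability distribution over the items $\{1,\dots,n\}$. Its regret is $$\mathrm{Reg}(\mathrm{Alg})=\sup_{v\in\mathbb R^n}\Bigl(\max_i v_i-\mathbb E_{a}\,\mathbb E_{i\sim \mathrm{Alg}(v+a)}[v_i]\Bigr)\in[0,\infty],$$ and $\mathrm{OPT}=\inf_{\mathrm{Alg}}\mathrm{Reg}(\mathrm{Alg})$ is the infimum over all algorithms. For a probability distribution $D$ on $\mathbb R$ let $\theta(D)$ be a minimizer over $t\in\mathbb R$ of $$\max\Bigl(\sup_{v>0}\Pr_{a\sim D}[a\le t-v]\cdot v,\ \sup_{v<0}\Pr_{a\sim D}[a\ge t-v]\cdot(-v)\Bigr).$$ Then for every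 $i$ a minimizer $\theta(A_i)$ exists. Moreover, for any choice of minimizers $\theta(A_i)$, every algorithm $\mathrm{Offset}_\theta$ that always picks an item $i$ maximizing $s_i-\theta(A_i)$, with ties broken by any (measurable, possibly randomized) rule, satisfies $$\mathrm{Reg}(\mathrm{Offset}_\theta)\le 57000\cdot\mathrm{OPT}.$$ -/

import Mathlib

open MeasureTheory ProbabilityTheory

noncomputable section

namespace NoisySelection

/-- A (possibly randomized) selection algorithm for `n` items: given the vector `s` of observed
values it returns a probability distribution over the items.  (The noise distributions are fixed
before the algorithm is chosen, so it may depend on them in any way.) -/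
abbrev Algorithm (n : ℕ) : Type :=
  {alg : Kernel (Fin n → ℝ) (Fin n) // IsMarkovKernel alg}

/-- The regret of `alg` on the value vector `v`, when the noises `a i` are drawn independently
with `a i` distributed as `A i`: the highest value minus the expected value of the picked item. -/
def regretAt {n : ℕ} (A : Fin n → Measure ℝ) (alg : Algorithm n) (v : Fin n → ℝ) : ℝ :=
  (⨆ i, v i) - ∫ a, (∫ i, v i ∂(alg.1 (v + a))) ∂(Measure.pi A)

/-- The regret of `alg`: the supremum, possibly `⊤`, of its regret over all value vectors. -/
def regret {n : ℕ} (A : Fin n → Measure ℝ) (alg : Algorithm n) : EReal :=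
  ⨆ v : Fin n → ℝ, (regretAt A alg v : EReal)

/-- The optimal regret: the infimum of the regrets of all algorithms. -/
def opt {n : ℕ} (A : Fin n → Measure ℝ) : EReal :=
  ⨅ alg : Algorithm n, regret A alg

/-- The worst-case regret of the threshold `t` when deciding between a sure `0` and a single item
of unknown value `v` observed with noise `D` (ties count as a mistake). -/
def thresholdRegret (D : Measure ℝ) (t : ℝ) : EReal :=
  max (⨆ v : Set.Ioi (0 : ℝ), ((D.real {a | a ≤ t - v} * v : ℝ) : EReal))
    (⨆ v : Set.Iio (0 : ℝ), ((D.real {a | t - v ≤ a} * (-v) : ℝ) : EReal))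

/-- `t` is a value of `θ(D)`, i.e. `t` minimizes the worst-case threshold regret. -/
def IsTheta (D : Measure ℝ) (t : ℝ) : Prop :=
  ∀ t' : ℝ, thresholdRegret D t ≤ thresholdRegret D t'

/-- `alg` is the algorithm `Offset` with offsets `θ i`, under some tie-breaking rule: on every
observation `s` it only picks items `i` that maximize `s i - θ i`. -/
def IsOffset {n : ℕ} (θ : Fin n → ℝ) (alg : Algorithm n) : Prop :=
  ∀ (s : Fin n → ℝ) (i : Fin n), alg.1 s {i} ≠ 0 → ∀ j, s j - θ j ≤ s i - θ i

/-- `Offset` exists as a measurable algorithm: break ties by the smallest index. -/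
theorem exists_isOffset {n : ℕ} (hn : 1 ≤ n) (θ : Fin n → ℝ) :
    ∃ alg : Algorithm n, IsOffset θ alg := by
  classical
  have : Nonempty (Fin n) := ⟨⟨0, hn⟩⟩
  have key : ∀ s : Fin n → ℝ, ∃ i : Fin n, (∀ j, s j - θ j ≤ s i - θ i) ∧
      ∀ j, j < i → s j - θ j < s i - θ i := by
    intro s
    obtain ⟨m, hm⟩ := Finite.exists_max (fun j => s j - θ j)
    obtain ⟨i, hi, hmin⟩ := (Set.toFinite {i | ∀ j, s j - θ j ≤ s i - θ i}).exists_minimal ⟨m, hm⟩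
    refine ⟨i, hi, fun j hj => lt_of_not_ge fun h => ?_⟩
    exact absurd (hmin (fun k => (hi k).trans h) hj.le) (not_le.mpr hj)
  choose f hf hf' using key
  have huniq : ∀ s i, f s = i ↔ ((∀ j, s j - θ j ≤ s i - θ i) ∧
      ∀ j, j < i → s j - θ j < s i - θ i) := by
    intro s i
    constructor
    · rintro rfl
      exact ⟨hf s, hf' s⟩
    · rintro ⟨h1, h2⟩
      rcases lt_trichotomy (f s) i with h | h | h
      · exact absurd (h2 _ h) (not_lt.mpr (hf s i))
      · exact h
      · exact absurd (hf' s _ h) (not_lt.mpr (h1 (f s)))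
  have hmeas : Measurable f := by
    refine measurable_to_countable' fun i => ?_
    have : f ⁻¹' {i} = {s | (∀ j, s j - θ j ≤ s i - θ i) ∧
        ∀ j, j < i → s j - θ j < s i - θ i} := by
      ext s
      exact huniq s i
    rw [this]
    measurability
  refine ⟨⟨Kernel.deterministic f hmeas, inferInstance⟩, fun s i hi j => ?_⟩
  have : f s = i := by
    by_contra h
    apply hi
    simp [Kernel.deterministic_apply, h]
  exact this ▸ hf s j

end NoisySelection

end

/-!
Fix a real number `r` that exceeds the regret of some algorithm; the claim is that the regret of
`Offset` is at most `57000 * r`. Write `b j = a j - θ j` for the centred noises.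

**Single items.** The loss of a threshold `t` on positive values is a nondecreasing `1`-Lipschitz
function of `t`, and the loss on negative values is a nonincreasing one. By the intermediate
value theorem they take a common value `R` at some `t`, which is a minimizer (`exists_isBalanced`,
`IsBalanced.isTheta`). Hence every minimizer `θ` has the tail bounds `P(b ≥ x) ≤ R / x` and
`P(b ≤ -x) ≤ R / x`. If there are two items, then `R ≤ 32 * r` (`IsBalanced.le_of_regretAt_le`):
play one item of unknown value against items of value zero. When its value `u` is positive, it is
missed with probability at most `r / u`; averaging over `u` and using the mass of the left tail, the
algorithm has to pick the item on most observations in a window around `t`. Negative values and the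
right tail force the opposite on the same window. The transfer from noisy averages to the window is
Fubini's theorem (`setLIntegral_le_of_noisy_le`).

**Many items.** The same transfer gives a lower bound that adds up over the items
(`sum_mul_tail_le`): for scales `w j ≥ 512 * r`, the sum over all items but one of
`w j * P(b j ≥ w j)` is at most `8 * r`. Let one item have value zero and the others independent
values uniform on `[-w j / 2, -w j / 4]`. Were item `j` of a positive value of order at least `w j`,
it would have to be picked with high probability, as `r` is much smaller than `w j`. The
observation is the same as when a noise of at least `w j` falls on the true value, so that `j` is
then picked with probability at least one half. This costs `w j / 4`, and the costs of the different
items add up because only one item is picked.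

**The offset algorithm.** Let `m` be the best item, `k` the runner-up and `Δ j = v m - v j`. If
`Offset` picks `j`, then `Δ j = O(r)`, or `b j ≥ Δ j / 4`, or both `b m ≤ -3 / 4 * Δ j` and
`b k ≤ Δ k - 3 / 4 * Δ j` (`IsOffset.ofReal_sub_le`). The second case is controlled by
`sum_mul_tail_le`. In the third case `Δ j` is at most `2 * Δ k`, which costs
`2 * Δ k * P(b m ≤ -3 / 4 * Δ k) = O(r)`, or at most `4 * min (-b m) (-b k)`, whose positive part
has mean `O(r)` because its tail is bounded by a product of two tails (`lintegral_min_le`).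
-/

namespace NoisySelection

open Set

/-! ### The threshold problem for a single item -/

/-- The real-valued supremum `sup_{v > 0} v * D(-∞, t - v]`: the loss of the threshold `t` on
items of positive value. -/
noncomputable def missLoss (D : Measure ℝ) (t : ℝ) : ℝ :=
  ⨆ v : Ioi (0 : ℝ), D.real {a | a ≤ t - v} * v

theorem missLoss_nonneg (D : Measure ℝ) (t : ℝ) : 0 ≤ missLoss D t :=
  Real.iSup_nonneg fun v => mul_nonneg measureReal_nonneg (le_of_lt v.2)

section missLoss

variable {D : Measure ℝ} [IsProbabilityMeasure D]

theorem bddAbove_missLoss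
    (hD : BddAbove ((fun x : ℝ => D.real {a | x ≤ |a|} * x) '' Ici 0)) (t : ℝ) :
    BddAbove (range fun v : Ioi (0 : ℝ) => D.real {a | a ≤ t - v} * v) := by
  obtain ⟨C, hC⟩ := hD
  refine ⟨max (2 * |t|) (2 * C), ?_⟩
  rintro _ ⟨⟨v, hv⟩, rfl⟩
  have hv0 : (0 : ℝ) < v := hv
  dsimp only
  rcases le_total v (2 * |t|) with h | h
  · refine le_max_of_le_left (le_trans ?_ h)
    exact mul_le_of_le_one_left hv0.le measureReal_le_one
  · refine le_max_of_le_right ?_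
    have h1 := hC (mem_image_of_mem _ (show v / 2 ∈ Ici (0 : ℝ) from (half_pos hv0).le))
    have h2 : D.real {a | a ≤ t - v} ≤ D.real {a | v / 2 ≤ |a|} := by
      refine measureReal_mono fun a ha => ?_
      simp only [mem_ofPred_eq] at ha ⊢
      have := le_abs_self t
      have := neg_le_abs a
      linarith
    nlinarith

theorem le_missLoss (hD : BddAbove ((fun x : ℝ => D.real {a | x ≤ |a|} * x) '' Ici 0))
    (t : ℝ) {v : ℝ} (hv : 0 < v) : D.real {a | a ≤ t - v} * v ≤ missLoss D t :=
  le_ciSup (bddAbove_missLoss hD t) (⟨v, hv⟩ : Ioi (0 : ℝ))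

theorem missLoss_mono (hD : BddAbove ((fun x : ℝ => D.real {a | x ≤ |a|} * x) '' Ici 0)) :
    Monotone (missLoss D) := by
  intro s t hst
  refine ciSup_le fun v => le_trans ?_ (le_missLoss hD t v.2)
  refine mul_le_mul_of_nonneg_right (measureReal_mono fun a ha => ?_) (le_of_lt v.2)
  simp only [mem_ofPred_eq] at ha ⊢
  linarith

/-- Lowering the threshold by `t - s` has the same effect as lowering the value by `t - s`, so the
loss changes by at most `t - s`. -/
theorem missLoss_le_add (hD : BddAbove ((fun x : ℝ => D.real {a | x ≤ |a|} * x) '' Ici 0))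
    {s t : ℝ} (hst : s ≤ t) : missLoss D t ≤ missLoss D s + (t - s) := by
  refine ciSup_le fun v => ?_
  have hv0 : (0 : ℝ) < v := v.2
  have hp : D.real {a | a ≤ t - v} ≤ 1 := measureReal_le_one
  have hp0 : 0 ≤ D.real {a | a ≤ t - v} := measureReal_nonneg
  rcases le_or_gt (v : ℝ) (t - s) with h | h
  · have := missLoss_nonneg D s
    nlinarith
  · have h1 := le_missLoss hD s (v := v - (t - s)) (by linarith)
    rw [show s - (v - (t - s)) = t - v by ring] at h1
    nlinarith

theorem continuous_missLoss
    (hD : BddAbove ((fun x : ℝ => D.real {a | x ≤ |a|} * x) '' Ici 0)) :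
    Continuous (missLoss D) := by
  refine (LipschitzWith.of_le_add fun x y => ?_).continuous
  rcases le_total x y with h | h
  · exact (missLoss_mono hD h).trans (le_add_of_nonneg_right dist_nonneg)
  · refine (missLoss_le_add hD h).trans ?_
    rw [Real.dist_eq]
    gcongr
    exact le_abs_self _

theorem exists_le_missLoss
    (hD : BddAbove ((fun x : ℝ => D.real {a | x ≤ |a|} * x) '' Ici 0)) :
    ∃ t₀ : ℝ, ∀ t, t₀ ≤ t → t / 4 ≤ missLoss D t := by
  obtain ⟨C, hC⟩ := hD
  refine ⟨4 * (|C| + 1), fun t ht => ?_⟩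
  have hCpos := abs_nonneg C
  have h1 := hC (mem_image_of_mem _ (show t / 2 ∈ Ici (0 : ℝ) by simp; linarith))
  have h2 := le_missLoss ⟨C, hC⟩ t (v := t / 2) (by linarith)
  have h3 : D.real {a | t / 2 ≤ |a|} ≤ 1 / 2 := by
    have := le_abs_self C
    by_contra! h
    nlinarith
  have h4 : 1 / 2 ≤ D.real {a | a ≤ t - t / 2} := by
    have hc : D.real {a | a ≤ t - t / 2}ᶜ ≤ D.real {a | t / 2 ≤ |a|} := by
      refine measureReal_mono fun a ha => ?_
      simp only [mem_compl_iff, mem_ofPred_eq, not_le] at ha ⊢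
      linarith [le_abs_self a]
    have hm : MeasurableSet {a : ℝ | a ≤ t - t / 2} := measurableSet_Iic
    rw [probReal_compl_eq_one_sub hm] at hc
    linarith
  nlinarith

end missLoss

/-- Reflecting the noise turns the loss on positive values into the loss on negative values. -/
theorem map_neg_real_setOf_le (D : Measure ℝ) (t v : ℝ) :
    (D.map Neg.neg).real {a | a ≤ -t - v} = D.real {a | t + v ≤ a} := by
  have hm : MeasurableSet {a : ℝ | a ≤ -t - v} := measurableSet_Iic
  rw [map_measureReal_apply measurable_neg hm]
  congr 1
  ext a
  simp only [mem_preimage, mem_ofPred_eq]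
  constructor <;> intro h <;> linarith

theorem bddAbove_map_neg {D : Measure ℝ}
    (hD : BddAbove ((fun x : ℝ => D.real {a | x ≤ |a|} * x) '' Ici 0)) :
    BddAbove ((fun x : ℝ => (D.map Neg.neg).real {a | x ≤ |a|} * x) '' Ici 0) := by
  convert hD using 1
  refine image_congr fun x _ => ?_
  have hm : MeasurableSet {a : ℝ | x ≤ |a|} :=
    measurableSet_le measurable_const continuous_abs.measurable
  rw [map_measureReal_apply measurable_neg hm]
  congr 2
  ext a
  simp

/-- The tails of `D` around `t` are at most `R / x` at distance `x`. -/
structure TailBound (D : Measure ℝ) (t R : ℝ) : Prop where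
  left : ∀ x, 0 < x → D.real {a | a ≤ t - x} * x ≤ R
  right : ∀ x, 0 < x → D.real {a | t + x ≤ a} * x ≤ R

theorem thresholdRegret_le_iff (D : Measure ℝ) (t R : ℝ) :
    thresholdRegret D t ≤ (R : EReal) ↔ TailBound D t R := by
  simp only [thresholdRegret, max_le_iff, iSup_le_iff, EReal.coe_le_coe_iff, Subtype.forall,
    mem_Ioi, mem_Iio]
  constructor
  · rintro ⟨h1, h2⟩
    refine ⟨h1, fun x hx => ?_⟩
    have := h2 (-x) (by linarith)
    simpa using this
  · rintro ⟨h1, h2⟩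
    refine ⟨h1, fun x hx => ?_⟩
    have := h2 (-x) (by linarith)
    simpa [sub_eq_add_neg] using this

/-- `t` balances both kinds of mistakes: the tail bound with constant `R` holds on both sides of
`t`, and on neither side does it hold with a smaller constant. -/
structure IsBalanced (D : Measure ℝ) (t R : ℝ) : Prop extends TailBound D t R where
  left_sharp : ∀ c, c < R → ∃ x, 0 < x ∧ c < D.real {a | a ≤ t - x} * x
  right_sharp : ∀ c, c < R → ∃ x, 0 < x ∧ c < D.real {a | t + x ≤ a} * x

theorem exists_isBalanced {D : Measure ℝ} [IsProbabilityMeasure D]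
    (hD : BddAbove ((fun x : ℝ => D.real {a | x ≤ |a|} * x) '' Ici 0)) :
    ∃ t R : ℝ, IsBalanced D t R := by
  have hD' := bddAbove_map_neg hD
  have : IsProbabilityMeasure (D.map Neg.neg) :=
    Measure.isProbabilityMeasure_map measurable_neg.aemeasurable
  obtain ⟨t₁, h₁⟩ := exists_le_missLoss hD
  obtain ⟨t₂, h₂⟩ := exists_le_missLoss hD'
  set L := missLoss D
  set U := fun t => missLoss (D.map Neg.neg) (-t) with hU
  have hcont : Continuous fun t => L t - U t :=
    (continuous_missLoss hD).sub ((continuous_missLoss hD').comp continuous_neg)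
  -- beyond `4 * U 0` the growing loss exceeds the shrinking one; symmetrically on the left
  obtain ⟨t, ht⟩ : ∃ t, L t - U t = 0 := by
    set p := max (max t₁ 0) (4 * U 0)
    set m := max (max t₂ 0) (4 * L 0)
    have hp0 : 0 ≤ p := (le_max_right _ _).trans (le_max_left _ _)
    have hm0 : 0 ≤ m := (le_max_right _ _).trans (le_max_left _ _)
    have hp : 0 ≤ L p - U p := by
      have a1 := h₁ p ((le_max_left _ _).trans (le_max_left _ _))
      have a2 : 4 * U 0 ≤ p := le_max_right _ _
      have a3 : U p ≤ U 0 := missLoss_mono hD' (by linarith)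
      linarith
    have hm : L (-m) - U (-m) ≤ 0 := by
      have a1 := h₂ m ((le_max_left _ _).trans (le_max_left _ _))
      have a2 : 4 * L 0 ≤ m := le_max_right _ _
      have a3 : L (-m) ≤ L 0 := missLoss_mono hD (by linarith)
      simp only [hU, neg_neg]
      linarith
    exact mem_range_of_exists_le_of_exists_ge hcont ⟨-m, hm⟩ ⟨p, hp⟩
  have hLU : L t = U t := by linarith
  refine ⟨t, L t, ⟨fun x hx => le_missLoss hD t hx, fun x hx => ?_⟩, fun c hc => ?_,
    fun c hc => ?_⟩
  · rw [hLU, ← map_neg_real_setOf_le]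
    exact le_missLoss hD' (-t) hx
  · obtain ⟨v, hv⟩ := exists_lt_of_lt_ciSup hc
    exact ⟨v, v.2, hv⟩
  · rw [hLU] at hc
    obtain ⟨v, hv⟩ := exists_lt_of_lt_ciSup hc
    rw [map_neg_real_setOf_le] at hv
    exact ⟨v, v.2, hv⟩

/-- Moving a balanced threshold in either direction increases one of the two losses. -/
theorem IsBalanced.isTheta {D : Measure ℝ} [IsProbabilityMeasure D] {t R : ℝ}
    (h : IsBalanced D t R) : IsTheta D t := by
  intro t'
  refine ((thresholdRegret_le_iff D t R).2 h.toTailBound).trans ?_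
  refine EReal.le_of_forall_lt_iff_le.1 fun c hc => ?_
  replace hc := hc.le
  rw [thresholdRegret_le_iff] at hc
  rw [EReal.coe_le_coe_iff]
  by_contra! hcR
  rcases le_total t t' with htt | htt
  · obtain ⟨x, hx, hlt⟩ := h.left_sharp c hcR
    have h1 : D.real {a | a ≤ t - x} ≤ D.real {a | a ≤ t' - x} :=
      measureReal_mono fun a ha => by simp only [mem_ofPred_eq] at ha ⊢; linarith
    nlinarith [hc.left x hx]
  · obtain ⟨x, hx, hlt⟩ := h.right_sharp c hcR
    have h1 : D.real {a | t + x ≤ a} ≤ D.real {a | t' + x ≤ a} :=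
      measureReal_mono fun a ha => by simp only [mem_ofPred_eq] at ha ⊢; linarith
    nlinarith [hc.right x hx]

theorem IsTheta.tailBound {D : Measure ℝ} {θ t R : ℝ} (hθ : IsTheta D θ)
    (h : TailBound D t R) : TailBound D θ R :=
  (thresholdRegret_le_iff D θ R).1 ((hθ t).trans ((thresholdRegret_le_iff D t R).2 h))

/-! ### From averages over the noise to averages over the observation -/

/-- If the noise lies in `[p, q]` with probability at least `m`, then a bound `ε` on the noisy
averages of `g` at all values `u` from which `[p, q]` can reach the window `[l, h]` bounds the
integral of `g` itself over that window: let `u` be uniformly distributed and use Fubini. -/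
theorem setLIntegral_le_of_noisy_le {D : Measure ℝ} [IsFiniteMeasure D] {g : ℝ → ENNReal}
    (hg : Measurable g) {l h p q m ε : ℝ} (hm : 0 < m)
    (hmD : m ≤ D.real (Icc p q)) (hε : 0 ≤ ε)
    (H : ∀ u, l - q ≤ u → u ≤ h - p → ∫⁻ a, g (u + a) ∂D ≤ ENNReal.ofReal ε) :
    ∫⁻ s in Icc l h, g s ≤ ENNReal.ofReal (ε * (h - l + (q - p)) / m) := by
  have hshift : ∀ a ∈ Icc p q, ∫⁻ s in Icc l h, g s ≤
      ∫⁻ u in Icc (l - q) (h - p), g (u + a) := by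
    intro a ha
    rw [← lintegral_indicator measurableSet_Icc, ← lintegral_indicator measurableSet_Icc,
      ← lintegral_add_right_eq_self _ a]
    refine lintegral_mono fun u => ?_
    by_cases hu : u + a ∈ Icc l h
    · rw [indicator_of_mem hu, indicator_of_mem]
      exact ⟨by linarith [hu.1, ha.2], by linarith [hu.2, ha.1]⟩
    · rw [indicator_of_notMem hu]
      exact zero_le
  have key : ENNReal.ofReal m * ∫⁻ s in Icc l h, g s ≤
      ENNReal.ofReal (ε * (h - l + (q - p))) :=
    calc ENNReal.ofReal m * ∫⁻ s in Icc l h, g s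
        ≤ D (Icc p q) * ∫⁻ s in Icc l h, g s := by
          gcongr
          exact ENNReal.ofReal_le_of_le_toReal hmD
      _ = ∫⁻ _ in Icc p q, (∫⁻ s in Icc l h, g s) ∂D := by
          rw [setLIntegral_const, mul_comm]
      _ ≤ ∫⁻ a in Icc p q, (∫⁻ u in Icc (l - q) (h - p), g (u + a)) ∂D :=
          setLIntegral_mono' measurableSet_Icc hshift
      _ ≤ ∫⁻ a, (∫⁻ u in Icc (l - q) (h - p), g (u + a)) ∂D := setLIntegral_le_lintegral _ _
      _ = ∫⁻ u in Icc (l - q) (h - p), (∫⁻ a, g (u + a) ∂D) :=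
          lintegral_lintegral_swap (by fun_prop)
      _ ≤ ∫⁻ _ in Icc (l - q) (h - p), ENNReal.ofReal ε :=
          setLIntegral_mono' measurableSet_Icc fun u hu => H u hu.1 hu.2
      _ = ENNReal.ofReal (ε * (h - l + (q - p))) := by
          rw [setLIntegral_const, Real.volume_Icc, ← ENNReal.ofReal_mul hε]
          congr 2
          ring
  have hm0 : ENNReal.ofReal m ≠ 0 := by simpa using hm
  rw [ENNReal.ofReal_div_of_pos hm, ENNReal.le_div_iff_mul_le (Or.inl hm0)
    (Or.inl ENNReal.ofReal_ne_top), mul_comm]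
  exact key

/-- Picking a single item with probability `f s` on observation `s` costs at least `R / 32` against
a sure zero. Both tails carry enough mass at some scales `v` and `w` that `f` has to be mostly one
and mostly zero on the same window `[t - v / 2, t + w / 2]`. -/
theorem IsBalanced.le_of_pick {D : Measure ℝ} [IsProbabilityMeasure D] {t R r : ℝ}
    (hR : IsBalanced D t R) (hr : 0 < r) {f g : ℝ → ENNReal} (hf : Measurable f)
    (hg : Measurable g) (hfg : ∀ s, f s + g s = 1)
    (hgr : ∀ u, 0 < u → ∫⁻ a, g (u + a) ∂D ≤ ENNReal.ofReal (r / u))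
    (hfr : ∀ u, 0 < u → ∫⁻ a, f (-u + a) ∂D ≤ ENNReal.ofReal (r / u)) : R ≤ 32 * r := by
  by_contra! hlt
  have hR0 : 0 < R := by linarith
  obtain ⟨v, hv, hvR⟩ := hR.left_sharp (3 / 4 * R) (by linarith)
  obtain ⟨w, hw, hwR⟩ := hR.right_sharp (3 / 4 * R) (by linarith)
  -- the tail bound at twice the distance leaves half of the tail mass within that distance
  have hvm : R / (4 * v) ≤ D.real (Icc (t - 2 * v) (t - v)) := by
    have h1 : D.real {a | a ≤ t - v} ≤
        D.real {a | a ≤ t - 2 * v} + D.real (Icc (t - 2 * v) (t - v)) := by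
      refine (measureReal_mono fun a ha => ?_).trans (measureReal_union_le _ _)
      simp only [mem_ofPred_eq] at ha
      rcases le_total a (t - 2 * v) with h | h
      · exact Or.inl h
      · exact Or.inr ⟨h, ha⟩
    have h2 := hR.left (2 * v) (by linarith)
    rw [div_le_iff₀ (by linarith)]
    nlinarith
  have hwm : R / (4 * w) ≤ D.real (Icc (t + w) (t + 2 * w)) := by
    have h1 : D.real {a | t + w ≤ a} ≤
        D.real {a | t + 2 * w ≤ a} + D.real (Icc (t + w) (t + 2 * w)) := by
      refine (measureReal_mono fun a ha => ?_).trans (measureReal_union_le _ _)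
      simp only [mem_ofPred_eq] at ha
      rcases le_total (t + 2 * w) a with h | h
      · exact Or.inl h
      · exact Or.inr ⟨ha, h⟩
    have h2 := hR.right (2 * w) (by linarith)
    rw [div_le_iff₀ (by linarith)]
    nlinarith
  have hG := setLIntegral_le_of_noisy_le (D := D) hg (l := t - v / 2) (h := t + w / 2)
    (p := t - 2 * v) (q := t - v) (ε := r / (v / 2)) (by positivity)
    hvm (by positivity) fun u hu _ => (hgr u (by linarith)).trans <|
      ENNReal.ofReal_le_ofReal <| by gcongr; linarith
  have hF := setLIntegral_le_of_noisy_le (D := D) hf (l := t - v / 2) (h := t + w / 2)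
    (p := t + w) (q := t + 2 * w) (ε := r / (w / 2)) (by positivity)
    hwm (by positivity) fun u _ hu => by
      have := hfr (-u) (by linarith)
      rw [neg_neg] at this
      exact this.trans <| ENNReal.ofReal_le_ofReal <| by gcongr; linarith
  have hsum : ENNReal.ofReal (w / 2 + v / 2) =
      (∫⁻ s in Icc (t - v / 2) (t + w / 2), f s) + ∫⁻ s in Icc (t - v / 2) (t + w / 2), g s := by
    rw [← lintegral_add_left hf]
    simp only [hfg, lintegral_one, Measure.restrict_apply_univ, Real.volume_Icc]
    congr 1
    ring
  have hle := hsum.le.trans (add_le_add hF hG)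
  have e1 : r / (w / 2) * (t + w / 2 - (t - v / 2) + (t + 2 * w - (t + w))) / (R / (4 * w)) =
      4 * r * (3 * w + v) / R := by
    field_simp
    ring
  have e2 : r / (v / 2) * (t + w / 2 - (t - v / 2) + (t - v - (t - 2 * v))) / (R / (4 * v)) =
      4 * r * (3 * v + w) / R := by
    field_simp
    ring
  rw [e1, e2, ← ENNReal.ofReal_add (by positivity) (by positivity),
    ENNReal.ofReal_le_ofReal_iff (by positivity), ← add_div (4 * r * (3 * w + v)),
    le_div_iff₀ hR0] at hle
  nlinarith

/-! ### Regret in terms of selection probabilities -/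

/-- The probability that `alg` picks an item from `S` when the values are `v`. -/
noncomputable def pickProb {n : ℕ} (A : Fin n → Measure ℝ) (alg : Algorithm n) (S : Set (Fin n))
    (v : Fin n → ℝ) : ENNReal :=
  ∫⁻ a, alg.1 (v + a) S ∂(Measure.pi A)

section

variable {n : ℕ} {A : Fin n → Measure ℝ}

theorem measurable_algorithm (alg : Algorithm n) (S : Set (Fin n)) :
    Measurable fun s => alg.1 s S :=
  Kernel.measurable_coe alg.1 S.toFinite.measurableSet

theorem ofReal_regretAt [Nonempty (Fin n)] [∀ i, IsProbabilityMeasure (A i)] (alg : Algorithm n)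
    (v : Fin n → ℝ) : ENNReal.ofReal (regretAt A alg v) =
      ∑ j, ENNReal.ofReal ((⨆ i, v i) - v j) * pickProb A alg {j} v := by
  have hmarkov : IsMarkovKernel alg.1 := alg.2
  set M := ⨆ i, v i with hM
  have hle : ∀ j, 0 ≤ M - v j := fun j => sub_nonneg.2 (le_ciSup (finite_range v).bddAbove j)
  have hm : ∀ j : Fin n, Measurable fun a => alg.1 (v + a) {j} := fun j =>
    (measurable_algorithm alg {j}).comp (measurable_const.add measurable_id)
  have hmr : ∀ j : Fin n, Measurable fun a => (alg.1 (v + a)).real {j} := fun j =>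
    (hm j).ennreal_toReal
  have hint : ∀ j : Fin n, Integrable (fun a => (alg.1 (v + a)).real {j}) (Measure.pi A) :=
    fun j => Integrable.of_bound (hmr j).aestronglyMeasurable 1 (.of_forall fun a => by
      rw [Real.norm_of_nonneg measureReal_nonneg]
      exact measureReal_le_one)
  have hinner : ∀ a, ∫ i, v i ∂(alg.1 (v + a)) =
      M - ∑ j, (M - v j) * (alg.1 (v + a)).real {j} := by
    intro a
    have h1 : ∑ j, (alg.1 (v + a)).real {j} = 1 := by
      simp
    rw [integral_fintype (Integrable.of_finite)]
    simp only [sub_mul, Finset.sum_sub_distrib, ← Finset.mul_sum, h1, smul_eq_mul]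
    simp only [mul_comm]
    ring
  have hr : regretAt A alg v = ∫ a, ∑ j, (M - v j) * (alg.1 (v + a)).real {j} ∂(Measure.pi A) := by
    simp only [regretAt, hinner]
    rw [integral_sub (integrable_const _)
      (integrable_finsetSum _ fun j _ => (hint j).const_mul _)]
    simp [hM]
  rw [hr, ofReal_integral_eq_lintegral_ofReal
    (integrable_finsetSum _ fun j _ => (hint j).const_mul _)
    (.of_forall fun a => Finset.sum_nonneg fun j _ => mul_nonneg (hle j) measureReal_nonneg)]
  simp only [pickProb]
  simp_rw [← lintegral_const_mul _ (hm _)]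
  rw [← lintegral_finsetSum _ fun j _ => (hm j).const_mul _]
  refine lintegral_congr fun a => ?_
  rw [ENNReal.ofReal_sum_of_nonneg fun j _ => mul_nonneg (hle j) measureReal_nonneg]
  refine Finset.sum_congr rfl fun j _ => ?_
  rw [ENNReal.ofReal_mul (hle j), ofReal_measureReal]

/-! ### Resampling one coordinate -/

theorem measurePreserving_update [∀ i, IsProbabilityMeasure (A i)] (j : Fin n) :
    MeasurePreserving (fun p : ℝ × (Fin n → ℝ) => Function.update p.2 j p.1)
      ((A j).prod (Measure.pi A)) (Measure.pi A) := by
  have hmeas : Measurable fun p : ℝ × (Fin n → ℝ) => Function.update p.2 j p.1 :=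
    measurable_update'.comp measurable_swap
  refine ⟨hmeas, (Measure.pi_eq fun s hs => ?_).symm⟩
  have hpre : (fun p : ℝ × (Fin n → ℝ) => Function.update p.2 j p.1) ⁻¹' univ.pi s =
      s j ×ˢ univ.pi (Function.update s j univ) := by
    ext ⟨x, a⟩
    simp only [mem_preimage, mem_pi, mem_univ, forall_const, mem_prod]
    constructor
    · intro h
      refine ⟨by simpa using h j, fun i => ?_⟩
      rcases eq_or_ne i j with rfl | hij
      · simp
      · simpa [hij] using h i
    · rintro ⟨h1, h2⟩ i
      rcases eq_or_ne i j with rfl | hij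
      · simpa using h1
      · simpa [hij] using h2 i
  rw [Measure.map_apply hmeas (.univ_pi hs), hpre, Measure.prod_prod, Measure.pi_pi,
    ← Finset.mul_prod_erase _ _ (Finset.mem_univ j),
    ← Finset.mul_prod_erase Finset.univ (fun i => A i (s i)) (Finset.mem_univ j)]
  rw [Function.update_self, measure_univ, one_mul]
  congr 1
  refine Finset.prod_congr rfl fun i hi => ?_
  rw [Function.update_of_ne (Finset.ne_of_mem_erase hi)]

theorem lintegral_lintegral_update [∀ i, IsProbabilityMeasure (A i)] (j : Fin n)
    {F : (Fin n → ℝ) → ENNReal} (hF : Measurable F) :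
    ∫⁻ x, ∫⁻ a, F (Function.update a j x) ∂(Measure.pi A) ∂(A j) = ∫⁻ a, F a ∂(Measure.pi A) := by
  have h := measurePreserving_update (A := A) j
  rw [← h.lintegral_comp hF]
  exact (lintegral_prod _ (hF.comp h.measurable).aemeasurable).symm

/-- The probability that `alg` picks an item from `S` given the observation `x` of item `j`, when
the other items have independent random values with laws `N i`. -/
noncomputable def condPick (A N : Fin n → Measure ℝ) (alg : Algorithm n) (S : Set (Fin n))
    (j : Fin n) (x : ℝ) : ENNReal :=
  ∫⁻ y, ∫⁻ a, alg.1 (Function.update (y + a) j x) S ∂(Measure.pi A) ∂(Measure.pi N)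

variable {N : Fin n → Measure ℝ} [∀ i, IsProbabilityMeasure (A i)]
  [∀ i, IsProbabilityMeasure (N i)]

theorem measurable_algorithm_update (alg : Algorithm n) (S : Set (Fin n)) (j : Fin n) :
    Measurable fun p : (ℝ × (Fin n → ℝ)) × (Fin n → ℝ) =>
      alg.1 (Function.update (p.1.2 + p.2) j p.1.1) S := by
  refine (measurable_algorithm alg S).comp ?_
  exact measurable_update'.comp
    (((measurable_snd.comp measurable_fst).add measurable_snd).prodMk
      (measurable_fst.comp measurable_fst))

theorem measurable_condPick (alg : Algorithm n) (S : Set (Fin n)) (j : Fin n) :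
    Measurable (condPick A N alg S j) :=
  (measurable_algorithm_update alg S j).lintegral_prod_right'.lintegral_prod_right'

theorem condPick_add_compl (alg : Algorithm n) (S : Set (Fin n)) (j : Fin n) (x : ℝ) :
    condPick A N alg S j x + condPick A N alg Sᶜ j x = 1 := by
  have hmarkov : IsMarkovKernel alg.1 := alg.2
  have hm := measurable_algorithm_update alg S j
  unfold condPick
  rw [← lintegral_add_left]
  · rw [← lintegral_one (μ := Measure.pi N) |>.trans measure_univ]
    refine lintegral_congr fun y => ?_
    rw [← lintegral_add_left]
    · rw [← lintegral_one (μ := Measure.pi A) |>.trans measure_univ]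
      exact lintegral_congr fun a => prob_add_prob_compl S.toFinite.measurableSet
    · exact hm.comp (g := fun p : (ℝ × (Fin n → ℝ)) × (Fin n → ℝ) => _)
        (f := fun a : Fin n → ℝ => ((x, y), a)) (by fun_prop)
  · exact hm.lintegral_prod_right'.comp (f := fun y : Fin n → ℝ => (x, y)) (by fun_prop)

theorem update_add_update (y a : Fin n → ℝ) (j : Fin n) (u x : ℝ) :
    Function.update y j u + Function.update a j x = Function.update (y + a) j (u + x) := by
  ext i
  rcases eq_or_ne i j with rfl | hij
  · simp
  · simp [hij]

theorem measurable_pickProb (alg : Algorithm n) (S : Set (Fin n)) :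
    Measurable (pickProb A alg S) := by
  have h : Measurable fun p : (Fin n → ℝ) × (Fin n → ℝ) => alg.1 (p.1 + p.2) S :=
    (measurable_algorithm alg S).comp (measurable_fst.add measurable_snd)
  exact h.lintegral_prod_right'

/-- Averaging the conditional selection probability over the noise of item `j` of value `u`. -/
theorem lintegral_condPick (alg : Algorithm n) (S : Set (Fin n)) (j : Fin n) (u : ℝ) :
    ∫⁻ x, condPick A N alg S j (u + x) ∂(A j) =
      ∫⁻ y, pickProb A alg S (Function.update y j u) ∂(Measure.pi N) := by
  have hm := measurable_algorithm_update alg S j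
  unfold condPick
  rw [lintegral_lintegral_swap]
  · refine lintegral_congr fun y => ?_
    have h := lintegral_lintegral_update (A := A) j
      (F := fun a => alg.1 (Function.update y j u + a) S)
      ((measurable_algorithm alg S).comp (measurable_const.add measurable_id))
    simp only [update_add_update] at h
    exact h
  · exact (hm.lintegral_prod_right'.comp
      (f := fun p : ℝ × (Fin n → ℝ) => (u + p.1, p.2)) (by fun_prop)).aemeasurable

theorem lintegral_lintegral_condPick (alg : Algorithm n) (S : Set (Fin n)) (j : Fin n) :
    ∫⁻ η, ∫⁻ x, condPick A N alg S j (η + x) ∂(A j) ∂(N j) =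
      ∫⁻ y, pickProb A alg S y ∂(Measure.pi N) := by
  simp only [lintegral_condPick]
  exact lintegral_lintegral_update j (measurable_pickProb alg S)

end

/-! ### Lower bounds for the regret of an arbitrary algorithm -/

section

variable {n : ℕ} {A N : Fin n → Measure ℝ} [∀ i, IsProbabilityMeasure (A i)]
  [∀ i, IsProbabilityMeasure (N i)] {alg : Algorithm n} {r : ℝ}

theorem pickProb_compl_le
    (hreg : ∀ v, ENNReal.ofReal (regretAt A alg v) ≤ ENNReal.ofReal r) {v : Fin n → ℝ}
    {j : Fin n} {u : ℝ} (hu : 0 < u) (hvj : v j = u) (hv : ∀ i, i ≠ j → v i ≤ 0) :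
    pickProb A alg {j}ᶜ v ≤ ENNReal.ofReal (r / u) := by
  have : Nonempty (Fin n) := ⟨j⟩
  have hM : u ≤ ⨆ i, v i := hvj ▸ le_ciSup (finite_range v).bddAbove j
  have hsum : pickProb A alg {j}ᶜ v = ∑ k ∈ Finset.univ.erase j, pickProb A alg {k} v := by
    simp only [pickProb]
    have hm : ∀ k, Measurable fun a => alg.1 (v + a) {k} := fun k =>
      (measurable_algorithm alg {k}).comp (measurable_const.add measurable_id)
    rw [← lintegral_finsetSum _ fun k _ => hm k]
    refine lintegral_congr fun a => ?_
    rw [sum_measure_singleton]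
    congr 1
    ext k
    simp
  have h := hreg v
  rw [ofReal_regretAt] at h
  rw [ENNReal.ofReal_div_of_pos hu, ENNReal.le_div_iff_mul_le (by simp [hu]) (by simp), hsum,
    Finset.sum_mul]
  refine le_trans ?_ h
  refine (Finset.sum_le_sum fun k hk => ?_).trans
    (Finset.sum_le_sum_of_subset (Finset.erase_subset j _))
  rw [mul_comm]
  gcongr
  linarith [hv k (Finset.ne_of_mem_erase hk)]

theorem sum_mul_pickProb_le
    (hreg : ∀ v, ENNReal.ofReal (regretAt A alg v) ≤ ENNReal.ofReal r) {v : Fin n → ℝ}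
    {b : Fin n} (hb : v b = 0) :
    ∑ j, ENNReal.ofReal (-v j) * pickProb A alg {j} v ≤ ENNReal.ofReal r := by
  have : Nonempty (Fin n) := ⟨b⟩
  have hM : 0 ≤ ⨆ i, v i := hb ▸ le_ciSup (finite_range v).bddAbove b
  have h := hreg v
  rw [ofReal_regretAt] at h
  refine le_trans (Finset.sum_le_sum fun k _ => ?_) h
  gcongr
  linarith

theorem ae_pi_forall {p : Fin n → ℝ → Prop} (h : ∀ i, ∀ᵐ η ∂(N i), p i η) :
    ∀ᵐ y ∂(Measure.pi N), ∀ i, p i (y i) :=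
  ae_all_iff.2 fun i => (Measure.tendsto_eval_ae_ae (μ := N) (i := i)).eventually (h i)

/-- An item of value `u > 0` competing against items of nonpositive values is missed with
probability at most `r / u`. -/
theorem lintegral_condPick_compl_le
    (hreg : ∀ v, ENNReal.ofReal (regretAt A alg v) ≤ ENNReal.ofReal r)
    (hN : ∀ i, ∀ᵐ η ∂(N i), η ≤ 0) (j : Fin n) {u : ℝ} (hu : 0 < u) :
    ∫⁻ x, condPick A N alg {j}ᶜ j (u + x) ∂(A j) ≤ ENNReal.ofReal (r / u) := by
  rw [lintegral_condPick]
  calc _ ≤ ∫⁻ _, ENNReal.ofReal (r / u) ∂(Measure.pi N) := by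
        refine lintegral_mono_ae ?_
        filter_upwards [ae_pi_forall hN] with y hy
        exact pickProb_compl_le hreg hu (Function.update_self j u y) fun i hi => by
          rw [Function.update_of_ne hi]
          exact hy i
    _ = ENNReal.ofReal (r / u) := by simp

/-- Each single item, played against the others with known value zero, forces a regret of at least
a constant fraction of its threshold loss. -/
theorem IsBalanced.le_of_regretAt_le {i b : Fin n} (hib : b ≠ i) {t R : ℝ}
    (hR : IsBalanced (A i) t R) (hr : 0 < r)
    (hreg : ∀ v, ENNReal.ofReal (regretAt A alg v) ≤ ENNReal.ofReal r) : R ≤ 32 * r := by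
  let N : Fin n → Measure ℝ := fun _ => Measure.dirac 0
  have hN : ∀ i, ∀ᵐ η ∂(N i), η = 0 := fun i => by simp [N]
  refine hR.le_of_pick hr (measurable_condPick (N := N) alg {i} i)
    (measurable_condPick (N := N) alg {i}ᶜ i) (condPick_add_compl alg {i} i)
    (fun u hu => lintegral_condPick_compl_le hreg (fun i => (hN i).mono fun _ h => h.le) i hu)
    fun u hu => ?_
  rw [lintegral_condPick]
  calc _ ≤ ∫⁻ _, ENNReal.ofReal (r / u) ∂(Measure.pi N) := by
        refine lintegral_mono_ae ?_
        filter_upwards [ae_pi_forall hN] with y hy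
        have h := sum_mul_pickProb_le hreg (v := Function.update y i (-u)) (b := b)
          (by rw [Function.update_of_ne hib, hy])
        rw [ENNReal.ofReal_div_of_pos hu, ENNReal.le_div_iff_mul_le (by simp [hu]) (by simp),
          mul_comm]
        refine le_trans ?_ ((Finset.single_le_sum (fun _ _ => zero_le) (Finset.mem_univ i)).trans h)
        simp
    _ = ENNReal.ofReal (r / u) := by simp

/-- An algorithm with regret `r` that reliably picks item `j` when its value is positive and at
least of the order of `w`, must also pick it when a value of order `-w` is hidden by a noise of at
least `w`. The value of item `j` is uniformly distributed on `[-w / 2, -w / 4]`. -/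
theorem half_mul_tail_le
    (hreg : ∀ v, ENNReal.ofReal (regretAt A alg v) ≤ ENNReal.ofReal r) (hr : 0 < r)
    (hN : ∀ i, ∀ᵐ η ∂(N i), η ≤ 0) {j : Fin n} {θ w : ℝ} (hw : 512 * r ≤ w)
    (hNj : N j = volume[|Icc (-w / 2) (-w / 4)]) (htail : TailBound (A j) θ (32 * r)) :
    2⁻¹ * A j {a | θ + w ≤ a} ≤ ∫⁻ y, pickProb A alg {j} y ∂(Measure.pi N) := by
  have hw0 : 0 < w := by linarith
  set f := condPick A N alg {j} j
  set g := condPick A N alg {j}ᶜ j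
  have hf : Measurable f := measurable_condPick alg {j} j
  have hg : Measurable g := measurable_condPick alg {j}ᶜ j
  have hfg : ∀ s, f s + g s = 1 := condPick_add_compl alg {j} j
  have hmass : 1 / 2 ≤ (A j).real (Icc (θ - w / 4) (θ + w / 4)) := by
    have h1 := htail.left (w / 4) (by linarith)
    have h2 := htail.right (w / 4) (by linarith)
    have h3 : (1 : ℝ) ≤ (A j).real {a | a ≤ θ - w / 4} + (A j).real {a | θ + w / 4 ≤ a} +
        (A j).real (Icc (θ - w / 4) (θ + w / 4)) := by
      rw [← probReal_univ (μ := A j)]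
      refine le_trans (measureReal_mono (s₂ := ({a | a ≤ θ - w / 4} ∪ {a | θ + w / 4 ≤ a}) ∪
        Icc (θ - w / 4) (θ + w / 4)) fun a _ => ?_) ((measureReal_union_le _ _).trans
        (by gcongr; exact measureReal_union_le _ _))
      simp only [mem_union, mem_ofPred_eq]
      rcases le_total a (θ - w / 4) with h | h
      · exact Or.inl (Or.inl h)
      rcases le_total (θ + w / 4) a with h' | h'
      · exact Or.inl (Or.inr h')
      · exact Or.inr ⟨h, h'⟩
    have h4 : (A j).real {a | a ≤ θ - w / 4} ≤ 1 / 4 := by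
      by_contra! h
      nlinarith
    have h5 : (A j).real {a | θ + w / 4 ≤ a} ≤ 1 / 4 := by
      by_contra! h
      nlinarith
    linarith
  -- for a noise `x`, the observation of item `j` is uniform on `[x - w / 2, x - w / 4]`; values
  -- `u ≥ w / 4` reach this window with probability at least one half
  have hhalf : ∀ x, θ + w ≤ x → 2⁻¹ ≤ ∫⁻ η, f (η + x) ∂(N j) := by
    intro x hx
    have hG := setLIntegral_le_of_noisy_le (D := A j) hg (l := x - w / 2) (h := x - w / 4)
      (p := θ - w / 4) (q := θ + w / 4) (m := 1 / 2) (ε := r / (w / 4)) (by norm_num) hmass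
      (by positivity) fun u hu _ =>
        (lintegral_condPick_compl_le hreg hN j (by linarith)).trans <|
          ENNReal.ofReal_le_ofReal <| by gcongr; linarith
    have hG' : ∫⁻ η, g (η + x) ∂(N j) ≤ 2⁻¹ := by
      have e1 : ∫⁻ s in Icc (x - w / 2) (x - w / 4), g s =
          ∫⁻ η in Icc (-w / 2) (-w / 4), g (η + x) := by
        rw [← lintegral_indicator measurableSet_Icc, ← lintegral_indicator measurableSet_Icc,
          ← lintegral_add_right_eq_self _ x]
        refine lintegral_congr fun η => ?_
        simp only [indicator, mem_Icc]
        congr 1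
        rw [eq_iff_iff]
        constructor <;> rintro ⟨h1, h2⟩ <;> constructor <;> linarith
      rw [hNj, ProbabilityTheory.cond, lintegral_smul_measure, ← e1, Real.volume_Icc, smul_eq_mul,
        mul_comm, ← div_eq_mul_inv]
      refine ENNReal.div_le_of_le_mul (hG.trans ?_)
      rw [show (2⁻¹ : ENNReal) = ENNReal.ofReal 2⁻¹ by
        rw [ENNReal.ofReal_inv_of_pos two_pos]; simp, ← ENNReal.ofReal_mul (by norm_num)]
      refine ENNReal.ofReal_le_ofReal ?_
      have e2 : r / (w / 4) * (x - w / 4 - (x - w / 2) + (θ + w / 4 - (θ - w / 4))) / (1 / 2) =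
          6 * r := by
        field_simp
        ring
      rw [e2]
      linarith
    have hsum : ∫⁻ η, f (η + x) ∂(N j) + ∫⁻ η, g (η + x) ∂(N j) = 1 := by
      rw [← lintegral_add_left (by fun_prop)]
      simp [hfg]
    have h2 : (2⁻¹ : ENNReal) + 2⁻¹ ≤ ∫⁻ η, f (η + x) ∂(N j) + 2⁻¹ := by
      rw [ENNReal.inv_two_add_inv_two, ← hsum]
      gcongr
    exact ENNReal.le_of_add_le_add_right (by simp) h2
  have hswap : Measurable (Function.uncurry fun η x => f (η + x)) :=
    hf.comp (measurable_fst.add measurable_snd)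
  rw [← lintegral_lintegral_condPick alg {j} j, lintegral_lintegral_swap hswap.aemeasurable]
  have hms : MeasurableSet {a : ℝ | θ + w ≤ a} := measurableSet_Ici
  calc 2⁻¹ * A j {a | θ + w ≤ a} = ∫⁻ _ in {a | θ + w ≤ a}, 2⁻¹ ∂(A j) := by
        rw [setLIntegral_const]
    _ ≤ ∫⁻ x in {a | θ + w ≤ a}, ∫⁻ η, f (η + x) ∂(N j) ∂(A j) :=
        setLIntegral_mono' hms fun x hx => hhalf x hx
    _ ≤ _ := setLIntegral_le_lintegral _ _

end

/-- At scales `w j` well above the regret `r` of some algorithm, the truncated losses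
`w j * P(a j ≥ θ j + w j)` add up to `O(r)`, over all items but one. Every item `j` of `J` has a
random value of order `-w j` and some item `b` has value zero, so that the regret counts every
wrong selection of an item of `J` with weight `w j / 4`. -/
theorem sum_mul_tail_le {n : ℕ} {A : Fin n → Measure ℝ} [∀ i, IsProbabilityMeasure (A i)]
    {alg : Algorithm n} {r : ℝ}
    (hreg : ∀ v, ENNReal.ofReal (regretAt A alg v) ≤ ENNReal.ofReal r) (hr : 0 < r)
    {θ w : Fin n → ℝ} {J : Finset (Fin n)} {b : Fin n} (hb : b ∉ J)
    (hw : ∀ j ∈ J, 512 * r ≤ w j) (htail : ∀ j ∈ J, TailBound (A j) (θ j) (32 * r)) :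
    ∑ j ∈ J, ENNReal.ofReal (w j) * A j {a | θ j + w j ≤ a} ≤ ENNReal.ofReal (8 * r) := by
  classical
  let N : Fin n → Measure ℝ := fun j =>
    if j ∈ J then volume[|Icc (-w j / 2) (-w j / 4)] else Measure.dirac 0
  have hNJ : ∀ j ∈ J, N j = volume[|Icc (-w j / 2) (-w j / 4)] := fun j hj => if_pos hj
  have hNJ' : ∀ j, j ∉ J → N j = Measure.dirac 0 := fun j hj => if_neg hj
  have hprob : ∀ j, IsProbabilityMeasure (N j) := by
    intro j
    by_cases hj : j ∈ J
    · rw [hNJ j hj]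
      refine cond_isProbabilityMeasure_of_finite ?_ ?_
      · rw [Real.volume_Icc]
        have := hw j hj
        simp only [ne_eq, ENNReal.ofReal_eq_zero, not_le]
        linarith
      · simp [Real.volume_Icc]
    · rw [hNJ' j hj]
      infer_instance
  have hsupp : ∀ j, ∀ᵐ η ∂(N j), η ≤ 0 ∧ (j ∈ J → η ≤ -(w j / 4)) ∧ (j ∉ J → η = 0) := by
    intro j
    by_cases hj : j ∈ J
    · rw [hNJ j hj]
      filter_upwards [ae_cond_mem (μ := volume) (s := Icc (-w j / 2) (-w j / 4))
        measurableSet_Icc] with η hη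
      have := hw j hj
      have := hη.2
      exact ⟨by linarith, fun _ => by linarith, fun h => absurd hj h⟩
    · rw [hNJ' j hj, ae_dirac_eq]
      exact ⟨le_rfl, fun h => absurd h hj, fun _ => rfl⟩
  have hbase : ∑ j ∈ J, ENNReal.ofReal (w j / 4) * ∫⁻ y, pickProb A alg {j} y ∂(Measure.pi N) ≤
      ENNReal.ofReal r := by
    simp_rw [← lintegral_const_mul _ (measurable_pickProb (A := A) alg _)]
    rw [← lintegral_finsetSum _ fun j _ => (measurable_pickProb alg {j}).const_mul _]
    calc _ ≤ ∫⁻ _, ENNReal.ofReal r ∂(Measure.pi N) := by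
          refine lintegral_mono_ae ?_
          filter_upwards [ae_pi_forall hsupp] with y hy
          refine le_trans ?_ (sum_mul_pickProb_le hreg (v := y) ((hy b).2.2 hb))
          refine (Finset.sum_le_sum fun j hj => ?_).trans
            (Finset.sum_le_sum_of_subset (Finset.subset_univ J))
          gcongr
          linarith [(hy j).2.1 hj]
      _ = ENNReal.ofReal r := by simp
  calc ∑ j ∈ J, ENNReal.ofReal (w j) * A j {a | θ j + w j ≤ a}
      = ∑ j ∈ J, 8 * (ENNReal.ofReal (w j / 4) * (2⁻¹ * A j {a | θ j + w j ≤ a})) := by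
        refine Finset.sum_congr rfl fun j _ => ?_
        have h8 : (8 : ENNReal) = 4 * 2 := by norm_num
        rw [ENNReal.ofReal_div_of_pos (by norm_num), ENNReal.ofReal_ofNat, h8, div_eq_mul_inv]
        have h4 : (4 : ENNReal) * 4⁻¹ = 1 := ENNReal.mul_inv_cancel (by simp) (by simp)
        have h2 : (2 : ENNReal) * 2⁻¹ = 1 := ENNReal.mul_inv_cancel (by simp) (by simp)
        calc _ = ENNReal.ofReal (w j) * (4 * 4⁻¹) * (2 * 2⁻¹) * A j {a | θ j + w j ≤ a} := by
              rw [h4, h2, mul_one, mul_one]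
          _ = _ := by ring
    _ ≤ 8 * ∑ j ∈ J, ENNReal.ofReal (w j / 4) * ∫⁻ y, pickProb A alg {j} y ∂(Measure.pi N) := by
        rw [Finset.mul_sum]
        gcongr with j hj
        exact half_mul_tail_le hreg hr (fun i => (hsupp i).mono fun _ h => h.1) (hw j hj)
          (hNJ j hj) (htail j hj)
    _ ≤ 8 * ENNReal.ofReal r := by gcongr
    _ = ENNReal.ofReal (8 * r) := by
        rw [ENNReal.ofReal_mul (by norm_num), ENNReal.ofReal_ofNat]

/-! ### The regret of the offset algorithm -/

theorem lintegral_ofReal_le_of_sq_tail {Ω : Type*} [MeasurableSpace Ω] {μ : Measure Ω}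
    [IsProbabilityMeasure μ] {Z : Ω → ℝ} (hZ : Measurable Z) {R : ℝ} (hR : 0 < R)
    (h : ∀ x, 0 < x → μ {ω | x ≤ Z ω} ≤ ENNReal.ofReal (R ^ 2 / x ^ 2)) :
    ∫⁻ ω, ENNReal.ofReal (Z ω) ∂μ ≤ ENNReal.ofReal (2 * R) := by
  have h0 : ∀ ω, ENNReal.ofReal (Z ω) = ENNReal.ofReal (max (Z ω) 0) := fun ω => by
    rw [ENNReal.ofReal_max, ENNReal.ofReal_zero, max_eq_left zero_le]
  simp only [h0]
  rw [lintegral_eq_lintegral_meas_le μ (f := fun ω => max (Z ω) 0)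
    (.of_forall fun ω => le_max_right _ _) (hZ.max measurable_const).aemeasurable]
  -- the tail is at most one below `R` and at most `R ^ 2 / x ^ 2` above
  have hset : ∀ x : ℝ, 0 < x → {ω | x ≤ max (Z ω) 0} = {ω | x ≤ Z ω} := fun x hx => by
    ext ω
    simp [hx.not_ge]
  have htail : ∫⁻ x in Ioi R, ENNReal.ofReal (R ^ 2 / x ^ 2) = ENNReal.ofReal R := by
    have hcongr : ∫⁻ x in Ioi R, ENNReal.ofReal (R ^ 2 / x ^ 2) =
        ∫⁻ x in Ioi R, ENNReal.ofReal (R ^ 2 * x ^ (-2 : ℝ)) := by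
      refine setLIntegral_congr_fun measurableSet_Ioi fun x hx => ?_
      have hx0 : 0 < x := hR.trans hx
      rw [Real.rpow_neg hx0.le, Real.rpow_two, div_eq_mul_inv]
    rw [hcongr, ← ofReal_integral_eq_lintegral_ofReal
      ((integrableOn_Ioi_rpow_of_lt (by norm_num) hR).const_mul _), integral_const_mul,
      integral_Ioi_rpow_of_lt (by norm_num) hR]
    · congr 1
      have : (-2 : ℝ) + 1 = -1 := by norm_num
      rw [this, Real.rpow_neg_one]
      field_simp
    · filter_upwards [ae_restrict_mem measurableSet_Ioi] with x hx
      have hx0 : 0 < x := hR.trans hx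
      positivity
  rw [← Ioc_union_Ioi_eq_Ioi hR.le]
  refine (lintegral_union_le _ _ _).trans ?_
  rw [two_mul, ENNReal.ofReal_add hR.le hR.le]
  refine add_le_add ?_ ?_
  · calc ∫⁻ x in Ioc 0 R, μ {ω | x ≤ max (Z ω) 0} ≤ ∫⁻ _ in Ioc 0 R, 1 :=
          lintegral_mono fun _ => prob_le_one
      _ = ENNReal.ofReal R := by simp
  · rw [← htail]
    refine setLIntegral_mono' measurableSet_Ioi fun x hx => ?_
    have hx0 : 0 < x := hR.trans hx
    rw [hset x hx0]
    exact h x hx0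

theorem TailBound.measure_left_le {D : Measure ℝ} [IsFiniteMeasure D] {t R : ℝ}
    (h : TailBound D t R) {x : ℝ} (hx : 0 < x) :
    D {a | a ≤ t - x} ≤ ENNReal.ofReal (R / x) := by
  rw [← ofReal_measureReal]
  exact ENNReal.ofReal_le_ofReal ((le_div_iff₀ hx).2 (h.left x hx))

section

variable {n : ℕ} {A : Fin n → Measure ℝ} [∀ i, IsProbabilityMeasure (A i)]

/-- Although a single noise with tails `R / x` need not have a mean, the smaller of two independent
ones does. -/
theorem lintegral_min_le {θ : Fin n → ℝ} {R : ℝ} (hR : 0 < R) {m k : Fin n} (hmk : m ≠ k)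
    (hm : TailBound (A m) (θ m) R) (hk : TailBound (A k) (θ k) R) :
    ∫⁻ a, ENNReal.ofReal (min (θ m - a m) (θ k - a k)) ∂(Measure.pi A) ≤
      ENNReal.ofReal (2 * R) := by
  refine lintegral_ofReal_le_of_sq_tail (by fun_prop) hR fun x hx => ?_
  have hind : IndepFun (fun a : Fin n → ℝ => a m) (fun a => a k) (Measure.pi A) :=
    (iIndepFun_pi (μ := A) (X := fun _ => id) fun _ => aemeasurable_id).indepFun hmk
  have hms : ∀ c : ℝ, MeasurableSet {a : ℝ | a ≤ c} := fun c => measurableSet_Iic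
  have hset : {a : Fin n → ℝ | x ≤ min (θ m - a m) (θ k - a k)} =
      (fun a => a m) ⁻¹' {a | a ≤ θ m - x} ∩ (fun a => a k) ⁻¹' {a | a ≤ θ k - x} := by
    ext a
    simp only [mem_ofPred_eq, le_min_iff, mem_inter_iff, mem_preimage]
    constructor <;> rintro ⟨h1, h2⟩ <;> constructor <;> linarith
  rw [hset, hind.measure_inter_preimage_eq_mul _ _ (hms _) (hms _)]
  have hev : ∀ i c, Measure.pi A ((fun a => a i) ⁻¹' {a | a ≤ c}) = A i {a | a ≤ c} := fun i c =>
    (measurePreserving_eval A i).measure_preimage (hms c).nullMeasurableSet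
  rw [hev, hev, show R ^ 2 / x ^ 2 = R / x * (R / x) by ring, ENNReal.ofReal_mul (by positivity)]
  exact mul_le_mul' (hm.measure_left_le hx) (hk.measure_left_le hx)

/-- If the offset algorithm picks an item `j` far below the best item `m`, then either `j` has a
noise of at least `(v m - v j) / 4`, or the noises of `m` and of the runner-up `k` are both so low
that neither of them beats `j`. -/
theorem IsOffset.ofReal_sub_le {θ : Fin n → ℝ} {alg : Algorithm n} (halg : IsOffset θ alg)
    {v a : Fin n → ℝ} {m k j : Fin n} (hkj : j ≠ m → v j ≤ v k) {T : ℝ} (hT : 0 ≤ T)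
    (hj : alg.1 (v + a) {j} ≠ 0) :
    ENNReal.ofReal (v m - v j) ≤ ENNReal.ofReal T +
      {a | a ≤ θ m - 3 / 4 * (v m - v k)}.indicator
        (fun _ => ENNReal.ofReal (2 * (v m - v k))) (a m) +
      ENNReal.ofReal 4 * ENNReal.ofReal (min (θ m - a m) (θ k - a k)) +
      if T < v m - v j then {a | θ j + (v m - v j) / 4 ≤ a}.indicator
        (fun _ => ENNReal.ofReal (v m - v j)) (a j) else 0 := by
  rcases le_or_gt (v m - v j) T with h1 | h1
  · exact (ENNReal.ofReal_le_ofReal h1).trans (by simp only [add_assoc]; exact le_self_add)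
  rw [if_pos h1]
  by_cases h2 : θ j + (v m - v j) / 4 ≤ a j
  · rw [indicator_of_mem (s := {a | θ j + (v m - v j) / 4 ≤ a}) h2]
    exact le_add_self
  have hm := halg _ _ hj m
  have hk := halg _ _ hj k
  simp only [Pi.add_apply] at hm hk
  have hjm : j ≠ m := by
    rintro rfl
    linarith
  have hjk := hkj hjm
  -- the noise of `m` is too low in both cases; in the second one so is that of `k`
  rcases le_or_gt (v m - v j) (2 * (v m - v k)) with h3 | h3
  · have hmem : a m ∈ {a | a ≤ θ m - 3 / 4 * (v m - v k)} := by
      simp only [mem_ofPred_eq]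
      linarith
    rw [indicator_of_mem hmem]
    refine (ENNReal.ofReal_le_ofReal h3).trans ?_
    rw [add_assoc, add_assoc]
    exact le_add_left le_self_add
  · rw [← ENNReal.ofReal_mul (by norm_num)]
    refine (ENNReal.ofReal_le_ofReal ?_).trans (le_add_right le_add_self)
    have : (v m - v j) / 4 ≤ min (θ m - a m) (θ k - a k) := by
      refine le_min ?_ ?_ <;> linarith
    linarith

/-- The offset algorithm has regret `O(r)` as soon as the tails of the noises are `O(r)` and the
contributions of the right tails at scales above `O(r)` add up to `O(r)`. -/
theorem IsOffset.ofReal_regretAt_le {θ : Fin n → ℝ} {alg : Algorithm n} (halg : IsOffset θ alg)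
    {r : ℝ} (hr : 0 < r) (hn : 2 ≤ n) (htail : ∀ i, TailBound (A i) (θ i) (32 * r))
    (hsum : ∀ (w : Fin n → ℝ) (J : Finset (Fin n)) (b : Fin n), b ∉ J →
      (∀ j ∈ J, 512 * r ≤ w j) →
      ∑ j ∈ J, ENNReal.ofReal (w j) * A j {a | θ j + w j ≤ a} ≤ ENNReal.ofReal (8 * r))
    (v : Fin n → ℝ) : ENNReal.ofReal (regretAt A alg v) ≤ ENNReal.ofReal (57000 * r) := by
  classical
  have hmarkov : IsMarkovKernel alg.1 := alg.2
  have : Nonempty (Fin n) := ⟨⟨0, by omega⟩⟩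
  have : Nontrivial (Fin n) := Fin.nontrivial_iff_two_le.2 hn
  obtain ⟨m, hm⟩ := Finite.exists_max v
  have hM : ⨆ i, v i = v m :=
    le_antisymm (ciSup_le hm) (le_ciSup (finite_range v).bddAbove m)
  obtain ⟨b, hbm⟩ := exists_ne m
  obtain ⟨k, hk, hkmax⟩ := Finset.exists_max_image (Finset.univ.erase m) v
    ⟨b, Finset.mem_erase.2 ⟨hbm, Finset.mem_univ b⟩⟩
  have hkm : k ≠ m := Finset.ne_of_mem_erase hk
  -- `T / 4 = 512 * r` is the smallest scale allowed in `hsum`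
  set T := 2048 * r with hT
  set J := Finset.univ.filter fun j => T < v m - v j with hJ
  set p := ENNReal.ofReal T
  set X : (Fin n → ℝ) → ENNReal := fun a => {a | a ≤ θ m - 3 / 4 * (v m - v k)}.indicator
    (fun _ => ENNReal.ofReal (2 * (v m - v k))) (a m) with hX
  set Y : (Fin n → ℝ) → ENNReal := fun a =>
    ENNReal.ofReal 4 * ENNReal.ofReal (min (θ m - a m) (θ k - a k)) with hY
  set W : Fin n → (Fin n → ℝ) → ENNReal := fun j a =>
    {a | θ j + (v m - v j) / 4 ≤ a}.indicator (fun _ => ENNReal.ofReal (v m - v j)) (a j) with hW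
  have hms : ∀ c : ℝ, MeasurableSet {a : ℝ | a ≤ c} := fun c => measurableSet_Iic
  have hms' : ∀ c : ℝ, MeasurableSet {a : ℝ | c ≤ a} := fun c => measurableSet_Ici
  have hXm : Measurable X := (measurable_const.indicator (hms _)).comp (measurable_pi_apply m)
  have hYm : Measurable Y := by fun_prop
  have hWm : ∀ j, Measurable (W j) := fun j =>
    (measurable_const.indicator (hms' _)).comp (measurable_pi_apply j)
  have hpoint : ∀ a, ∑ j, ENNReal.ofReal (v m - v j) * alg.1 (v + a) {j} ≤
      p + X a + Y a + ∑ j ∈ J, W j a := by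
    intro a
    have hone : ∑ j, alg.1 (v + a) {j} = 1 := by
      rw [sum_measure_singleton, Finset.coe_univ, measure_univ]
    calc ∑ j, ENNReal.ofReal (v m - v j) * alg.1 (v + a) {j}
        ≤ ∑ j, ((p + X a + Y a) * alg.1 (v + a) {j} + if T < v m - v j then W j a else 0) := by
          refine Finset.sum_le_sum fun j _ => ?_
          by_cases hj : alg.1 (v + a) {j} = 0
          · simp [hj]
          · have h := halg.ofReal_sub_le (m := m) (k := k)
              (fun hjm => hkmax j (Finset.mem_erase.2 ⟨hjm, Finset.mem_univ j⟩))
              (by positivity : 0 ≤ T) hj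
            refine (mul_le_mul_left h _).trans ?_
            rw [add_mul]
            gcongr
            exact mul_le_of_le_one_right zero_le prob_le_one
      _ = p + X a + Y a + ∑ j ∈ J, W j a := by
          rw [Finset.sum_add_distrib, ← Finset.mul_sum, hone, mul_one, hJ, Finset.sum_filter]
  have hXle : ∫⁻ a, X a ∂(Measure.pi A) ≤ ENNReal.ofReal (86 * r) := by
    have e : ∫⁻ a, X a ∂(Measure.pi A) =
        ENNReal.ofReal (2 * (v m - v k)) * A m {a | a ≤ θ m - 3 / 4 * (v m - v k)} := by
      rw [(measurePreserving_eval A m).lintegral_comp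
        (f := {a | a ≤ θ m - 3 / 4 * (v m - v k)}.indicator
        (fun _ => ENNReal.ofReal (2 * (v m - v k)))) (measurable_const.indicator (hms _)),
        lintegral_indicator_const (hms _)]
    rw [e]
    rcases (sub_nonneg.2 (hm k)).eq_or_lt with h0 | h0
    · simp [← h0]
    · refine (mul_le_mul_right ((htail m).measure_left_le (by positivity)) _).trans ?_
      rw [← ENNReal.ofReal_mul (by positivity)]
      refine ENNReal.ofReal_le_ofReal ?_
      have e2 : 2 * (v m - v k) * (32 * r / (3 / 4 * (v m - v k))) = 256 / 3 * r := by
        field_simp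
        ring
      rw [e2]
      linarith
  have hYle : ∫⁻ a, Y a ∂(Measure.pi A) ≤ ENNReal.ofReal (256 * r) := by
    rw [lintegral_const_mul _ (by fun_prop)]
    refine (mul_le_mul_right
      (lintegral_min_le (by positivity) hkm.symm (htail m) (htail k)) _).trans ?_
    rw [← ENNReal.ofReal_mul (by norm_num)]
    exact ENNReal.ofReal_le_ofReal (by linarith)
  have hWle : ∑ j ∈ J, ∫⁻ a, W j a ∂(Measure.pi A) ≤ ENNReal.ofReal (32 * r) := by
    have e : ∀ j, ∫⁻ a, W j a ∂(Measure.pi A) = ENNReal.ofReal 4 *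
        (ENNReal.ofReal ((v m - v j) / 4) * A j {a | θ j + (v m - v j) / 4 ≤ a}) := by
      intro j
      rw [(measurePreserving_eval A j).lintegral_comp
        (f := {a | θ j + (v m - v j) / 4 ≤ a}.indicator
        (fun _ => ENNReal.ofReal (v m - v j))) (measurable_const.indicator (hms' _)),
        lintegral_indicator_const (hms' _), ← mul_assoc, ← ENNReal.ofReal_mul (by norm_num),
        mul_div_cancel₀ _ (by norm_num)]
    simp only [e, ← Finset.mul_sum]
    have hmJ : m ∉ J := by
      simp only [hJ, Finset.mem_filter, Finset.mem_univ, true_and, sub_self, not_lt]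
      positivity
    refine (mul_le_mul_right (hsum (fun j => (v m - v j) / 4) J m hmJ fun j hj => ?_) _).trans ?_
    · have := (Finset.mem_filter.1 hj).2
      linarith
    · rw [← ENNReal.ofReal_mul (by norm_num)]
      exact ENNReal.ofReal_le_ofReal (by linarith)
  have hmeas : ∀ j : Fin n, Measurable fun a => alg.1 (v + a) {j} := fun j =>
    (measurable_algorithm alg {j}).comp (measurable_const.add measurable_id)
  rw [ofReal_regretAt, hM]
  simp only [pickProb]
  simp_rw [← lintegral_const_mul _ (hmeas _)]
  rw [← lintegral_finsetSum _ fun j _ => (hmeas j).const_mul _]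
  calc ∫⁻ a, ∑ j, ENNReal.ofReal (v m - v j) * alg.1 (v + a) {j} ∂(Measure.pi A)
      ≤ ∫⁻ a, (p + X a + Y a + ∑ j ∈ J, W j a) ∂(Measure.pi A) := lintegral_mono hpoint
    _ = p + ∫⁻ a, X a ∂(Measure.pi A) + ∫⁻ a, Y a ∂(Measure.pi A) +
        ∑ j ∈ J, ∫⁻ a, W j a ∂(Measure.pi A) := by
        rw [lintegral_add_left (by fun_prop), lintegral_add_left (by fun_prop),
          lintegral_add_left (by fun_prop), lintegral_finsetSum _ fun j _ => hWm j]
        simp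
    _ ≤ p + ENNReal.ofReal (86 * r) + ENNReal.ofReal (256 * r) + ENNReal.ofReal (32 * r) := by
        gcongr
    _ ≤ ENNReal.ofReal (57000 * r) := by
        rw [← ENNReal.ofReal_add (by positivity) (by positivity),
          ← ENNReal.ofReal_add (by positivity) (by positivity),
          ← ENNReal.ofReal_add (by positivity) (by positivity)]
        exact ENNReal.ofReal_le_ofReal (by linarith)

end

/-! ### Comparison with the optimal regret -/

theorem regret_nonneg {n : ℕ} (hn : 1 ≤ n) (A : Fin n → Measure ℝ) (alg : Algorithm n) :
    0 ≤ regret A alg := by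
  have : Nonempty (Fin n) := ⟨⟨0, hn⟩⟩
  have h : regretAt A alg 0 = 0 := by simp [regretAt]
  exact le_iSup_of_le (f := fun v => (regretAt A alg v : EReal)) 0 (by rw [h]; rfl)

theorem opt_nonneg {n : ℕ} (hn : 1 ≤ n) (A : Fin n → Measure ℝ) : 0 ≤ opt A :=
  le_iInf fun alg => regret_nonneg hn A alg

theorem regret_le_of_subsingleton {n : ℕ} [Subsingleton (Fin n)] [Nonempty (Fin n)]
    (A : Fin n → Measure ℝ) [∀ i, IsProbabilityMeasure (A i)] (alg : Algorithm n) :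
    regret A alg ≤ 0 := by
  refine iSup_le fun v => ?_
  have h0 : ∀ j, (⨆ i, v i) - v j = 0 := fun j => by
    have : ∀ i, v i = v j := fun i => congrArg v (Subsingleton.elim i j)
    simp [this]
  have h := ofReal_regretAt (A := A) alg v
  simp only [h0, ENNReal.ofReal_zero, zero_mul, Finset.sum_const_zero,
    ENNReal.ofReal_eq_zero] at h
  exact_mod_cast h

theorem IsOffset.regret_le {n : ℕ} (hn : 2 ≤ n) {A : Fin n → Measure ℝ}
    [∀ i, IsProbabilityMeasure (A i)]
    (hA : ∀ i, BddAbove ((fun x : ℝ => (A i).real {a | x ≤ |a|} * x) '' Ici 0))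
    {θ : Fin n → ℝ} (hθ : ∀ i, IsTheta (A i) (θ i)) {alg alg₀ : Algorithm n}
    (halg : IsOffset θ alg) {r : ℝ} (hr : 0 < r) (h₀ : regret A alg₀ ≤ r) :
    regret A alg ≤ ((57000 * r : ℝ) : EReal) := by
  have : Nontrivial (Fin n) := Fin.nontrivial_iff_two_le.2 hn
  have hreg : ∀ v, ENNReal.ofReal (regretAt A alg₀ v) ≤ ENNReal.ofReal r := fun v =>
    ENNReal.ofReal_le_ofReal (EReal.coe_le_coe_iff.1
      ((le_iSup (fun v => (regretAt A alg₀ v : EReal)) v).trans h₀))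
  have htail : ∀ i, TailBound (A i) (θ i) (32 * r) := by
    intro i
    obtain ⟨b, hb⟩ := exists_ne i
    obtain ⟨t, R, hR⟩ := exists_isBalanced (hA i)
    have hle : R ≤ 32 * r := hR.le_of_regretAt_le hb hr hreg
    have h := (hθ i).tailBound hR.toTailBound
    exact ⟨fun x hx => (h.left x hx).trans hle, fun x hx => (h.right x hx).trans hle⟩
  refine iSup_le fun v => EReal.coe_le_coe_iff.2 ?_
  refine (ENNReal.ofReal_le_ofReal_iff (by positivity)).1
    (halg.ofReal_regretAt_le hr hn htail (fun w J b hb hw => ?_) v)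
  exact sum_mul_tail_le hreg hr hb hw fun j _ => htail j

end NoisySelection

theorem mainTheorem1 (n : ℕ) (hn : 1 ≤ n) (A : Fin n → MeasureTheory.Measure ℝ)
    [∀ i, MeasureTheory.IsProbabilityMeasure (A i)]
    (hA : ∀ i, BddAbove ((fun x : ℝ => (A i).real {a | x ≤ |a|} * x) '' Set.Ici 0)) :
    (∀ i, ∃ t : ℝ, NoisySelection.IsTheta (A i) t) ∧
      ∀ θ : Fin n → ℝ, (∀ i, NoisySelection.IsTheta (A i) (θ i)) →
        ∀ alg : NoisySelection.Algorithm n, NoisySelection.IsOffset θ alg →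
          NoisySelection.regret A alg ≤ 57000 * NoisySelection.opt A := by
  refine ⟨fun i => ?_, fun θ hθ alg halg => ?_⟩
  · obtain ⟨t, R, hR⟩ := NoisySelection.exists_isBalanced (hA i)
    exact ⟨t, hR.isTheta⟩
  have hopt := NoisySelection.opt_nonneg hn A
  -- a single item is picked by every algorithm; the lower bounds on the regret need a second one
  rcases hn.eq_or_lt with rfl | hn2
  · exact (NoisySelection.regret_le_of_subsingleton A alg).trans
      (mul_nonneg (by norm_num) hopt)
  refine EReal.le_of_forall_lt_iff_le.1 fun c hc => ?_
  have hc' : NoisySelection.opt A < ((c / 57000 : ℝ) : EReal) := by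
    by_contra! h
    refine hc.not_ge ?_
    calc (c : EReal) = 57000 * ((c / 57000 : ℝ) : EReal) := by
          have h57000 : (57000 : EReal) = ((57000 : ℝ) : EReal) := rfl
          rw [h57000, ← EReal.coe_mul]
          congr 1
          ring
      _ ≤ 57000 * NoisySelection.opt A := by gcongr
  obtain ⟨alg₀, h₀⟩ := iInf_lt_iff.1 hc'
  have hr : 0 < c / 57000 := by
    exact_mod_cast (NoisySelection.regret_nonneg hn A alg₀).trans_lt h₀
  have h := halg.regret_le hn2 hA hθ hr h₀.le
  rwa [show 57000 * (c / 57000) = c by ring] at h
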